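/- Let $d,p\in\mathbb{N}$ with $p\ge 2$, let $M$ be a second-countable Hausdorff manifold of class (at least) $C^p$ and of dimension $d$, and let $f:M\to\mathbb{R}$ be a non-negative function of class $C^p$ with zero set $\mathcal{Z}=\{x\in M: f(x)=0\}$. Every $x\in\mathcal{Z}$ is a critical point of $f$, so the Hessian $H_f(x)$ is a well-defined symmetric bilinear form on $T_xM$, given in any chart $\phi$ around $x$ by $H_f(x)[\xi,\eta]=d^2(f\circ\phi^{-1})(\phi(x))[d\phi(x)\xi,d\phi(x)\eta]$. Assume that $f$ satisfies the global normal Hessian condition: for every $x\in\mathcal{Z}$ there are an integer $0\le d_0\le d$ and an embedded sub-manifold $N$ of $M$, of dimension $d_0$ and of class $C^k$ for some $k\ge 1$, such that $x\in N\subset\mathcal{Z}$ and $H_f(x)$ has rank $d-d_0$. Then there are an at most countable set $I$ and functions $f_i\in C^{p-2}(M)$, $i\in I$, whose family of supports is locally finite, such that $$f(x)=\sum_{i\in I}f_i(x)^2\qquad\text{for all }x\in M.$$ Moreover: - if $f$ satisfies the strict Hessian condition, that is, if $H_f(x)$ is positive definite for every $x\in\mathcal{Z}$, then $\mathcal{Z}$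 is discrete and such a decomposition exists with $|I|\le d+1$; - if $\mathcal{Z}$ is compact, then such a decomposition exists with $I$ finite. -/

import Mathlib

open scoped Manifold ContDiff Topology

namespace SumOfSquares

/-- `φ`, restricted to the open neighbourhood `U` of `0` in `ℝ^d₀`, is a local parametrization of
class `C^k` of the subset `N` of `ℝ^d` around the point `x₀`. -/
structure IsLocalParametrization {d d₀ : ℕ} (k : ℕ) (N : Set (EuclideanSpace ℝ (Fin d)))
    (x₀ : EuclideanSpace ℝ (Fin d)) (U : Set (EuclideanSpace ℝ (Fin d₀)))
    (φ : EuclideanSpace ℝ (Fin d₀) → EuclideanSpace ℝ (Fin d)) : Prop where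
  isOpen : IsOpen U
  zero_mem : 0 ∈ U
  contDiffOn : ContDiffOn ℝ k φ U
  map_zero : φ 0 = x₀
  image_eq : ∃ V : Set (EuclideanSpace ℝ (Fin d)), IsOpen V ∧ φ '' U = N ∩ V
  /-- `φ : U → φ(U)` is a homeomorphism. -/
  isEmbedding : Topology.IsEmbedding (U.domRestrict φ)
  injective_fderiv : Function.Injective (fderiv ℝ φ 0)

/-- `N` is a sub-manifold of `ℝ^d` of class `C^k` and of dimension `d₀` (meaningful for `1 ≤ k`). -/
def IsEuclideanSubmanifold {d : ℕ} (k d₀ : ℕ) (N : Set (EuclideanSpace ℝ (Fin d))) : Prop :=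
  ∀ x ∈ N, ∃ (U : Set (EuclideanSpace ℝ (Fin d₀)))
    (φ : EuclideanSpace ℝ (Fin d₀) → EuclideanSpace ℝ (Fin d)), IsLocalParametrization k N x U φ

section Manifold

variable (d : ℕ) {M : Type*} [TopologicalSpace M] [ChartedSpace (EuclideanSpace ℝ (Fin d)) M]

/-- `N` is an (embedded) sub-manifold of class `C^k` and of dimension `d₀` of the `d`-dimensional
manifold `M`: the manifold `M` is of class `C^k`, and `N` is a sub-manifold of `ℝ^d` when read in
any chart of `M` of class `C^k` around any point of `N`. -/
structure IsSubmanifold (k d₀ : ℕ) (N : Set M) : Prop where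
  isManifold : IsManifold (𝓡 d) k M
  image_chart : ∀ x ∈ N, ∀ e ∈ IsManifold.maximalAtlas (𝓡 d) k M, x ∈ e.source →
    IsEuclideanSubmanifold k d₀ (e '' (e.source ∩ N))

/-- The Hessian of `f` at `x`, a bilinear form on the tangent space of `M` at `x`: the second
differential at `φ x` of `f ∘ φ⁻¹`, where `φ` is the preferred chart of `M` at `x`. The tangent
space `TangentSpace (𝓡 d) x` is by definition `ℝ^d`, read through that same chart. At a critical
point `x` of `f` (in particular at a zero of a non-negative differentiable `f`) this form does not
depend on the chart; it is only used at such points. -/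
noncomputable def hessian (f : M → ℝ) (x : M) :
    EuclideanSpace ℝ (Fin d) →L[ℝ] EuclideanSpace ℝ (Fin d) →L[ℝ] ℝ :=
  fderiv ℝ (fderiv ℝ (f ∘ (chartAt (EuclideanSpace ℝ (Fin d)) x).symm))
    (chartAt (EuclideanSpace ℝ (Fin d)) x x)

/-- The set of zeros of `f`. -/
def zeros {M : Type*} (f : M → ℝ) : Set M := {x | f x = 0}

/-- The normal Hessian condition at `x`: the point `x` lies on a sub-manifold of `M`, of class
`C^k` with `1 ≤ k` and of some dimension `d₀ ≤ d`, that consists of zeros of `f`, and the Hessian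
of `f` at `x` has rank `d - d₀`. -/
def NormalHessianConditionAt (f : M → ℝ) (x : M) : Prop :=
  ∃ d₀ ≤ d, ∃ (k : ℕ) (N : Set M), 1 ≤ k ∧ IsSubmanifold d k d₀ N ∧ x ∈ N ∧ N ⊆ zeros f ∧
    Module.finrank ℝ (hessian d f x).range = d - d₀

/-- The global normal Hessian condition: the normal Hessian condition at every zero of `f`. -/
def GlobalNormalHessianCondition (f : M → ℝ) : Prop :=
  ∀ x ∈ zeros f, NormalHessianConditionAt d f x

/-- The strict Hessian condition: the Hessian of `f` is positive definite at every zero of `f`. -/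
def StrictHessianCondition (f : M → ℝ) : Prop :=
  ∀ x ∈ zeros f, ∀ ξ : EuclideanSpace ℝ (Fin d), ξ ≠ 0 → 0 < hessian d f x ξ ξ

/-- The family `g` consists of functions of class `C^q` on `M`, it has locally finite support,
and the sum of the squares of its members is `f`. -/
structure IsSumOfSquaresOf (q : ℕ) (f : M → ℝ) {ι : Type} (g : ι → M → ℝ) : Prop where
  contMDiff : ∀ i, ContMDiff (𝓡 d) 𝓘(ℝ, ℝ) q (g i)
  locallyFinite : LocallyFinite fun i => tsupport (g i)
  hasSum : ∀ x, HasSum (fun i => g i x ^ 2) (f x)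

end Manifold

end SumOfSquares

/-! Near a zero x₀, work in a chart, with H the Hessian at x₀ and K its kernel. The differential of
f vanishes at every zero, hence along N; with the rank condition this forces the tangent space of N
at x₀ to be K (`range_eq_ker_hessian`). So N projects onto a neighbourhood in K, and each x near x₀
has a zero P x with x - P x orthogonal to K. The map P takes its smoothness from f and not from N,
being read off a local inverse of x ↦ df(x) + Q(x - x₀), where Q is the projection form onto K
(`exists_contDiffAt_retraction`).

Taylor's formula centred at P x has no terms of order 0 and 1, so f(x) = R(x, P x)[x - P x, x - P
x], with an integral remainder R of class C^(p-2); this is where two derivatives are lost. The form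
R(x₀, x₀) = H/2 is only semidefinite, but R + Q is definite near x₀ and Q vanishes on x - P x. A
smooth symmetric square root of a Gram matrix then gives d squares
(`exists_contDiffAt_sum_sq_of_contDiff`).

Away from the zeros, √f is as smooth as f. Bump functions glue it to the local decompositions
(`exists_isSumOfSquaresOf_of_near_zeros`). If the zeros are isolated, the local pieces can be added
before squaring, which leaves d + 1 functions. -/

namespace SumOfSquares

open Filter Set MeasureTheory

/-! ### Smoothness of integrals depending on a parameter -/

section ParametricIntegral

universe u

theorem hasFDerivAt_parametric_intervalIntegral {E F : Type*} [NormedAddCommGroup E]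
    [NormedSpace ℝ E] [FiniteDimensional ℝ E] [NormedAddCommGroup F] [NormedSpace ℝ F]
    {f : E × ℝ → F} (hf : ContDiff ℝ 1 f) (a b : ℝ) (x₀ : E) :
    HasFDerivAt (fun x => ∫ t in a..b, f (x, t))
      (∫ t in a..b, (fderiv ℝ f (x₀, t)).comp (ContinuousLinearMap.inl ℝ E ℝ)) x₀ := by
  have hc : Continuous fun z : E × ℝ =>
      (fderiv ℝ f z).comp (ContinuousLinearMap.inl ℝ E ℝ) :=
    (hf.continuous_fderiv one_ne_zero).clm_comp continuous_const
  have : ProperSpace E := FiniteDimensional.proper ℝ E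
  obtain ⟨C, hC⟩ := ((isCompact_closedBall x₀ 1).prod (isCompact_uIcc (a := a) (b := b))).exists_bound_of_continuousOn
    hc.continuousOn
  refine intervalIntegral.hasFDerivAt_integral_of_dominated_of_fderiv_le (bound := fun _ => C)
    (F := fun x t => f (x, t))
    (F' := fun x t => (fderiv ℝ f (x, t)).comp (ContinuousLinearMap.inl ℝ E ℝ))
    (Metric.closedBall_mem_nhds x₀ one_pos) ?_ ?_ ?_ ?_ ?_ ?_
  · exact Eventually.of_forall fun x =>
      (hf.continuous.comp (Continuous.prodMk_right x)).aestronglyMeasurable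
  · exact (hf.continuous.comp (Continuous.prodMk_right x₀)).intervalIntegrable _ _
  · exact (hc.comp (Continuous.prodMk_right x₀)).aestronglyMeasurable
  · exact Eventually.of_forall fun t ht x hx => hC (x, t) ⟨hx, uIoc_subset_uIcc ht⟩
  · exact intervalIntegrable_const
  · refine Eventually.of_forall fun t _ x _ => ?_
    exact ((hf.differentiable one_ne_zero (x, t)).hasFDerivAt).comp x (hasFDerivAt_prodMk_left x t)

/-- Each differentiation under the integral replaces the target `F` by `E →L[ℝ] F`; hence the
induction over all `F`, in the universe of `E`. -/
theorem contDiff_parametric_intervalIntegral {E : Type u} [NormedAddCommGroup E]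
    [NormedSpace ℝ E] [FiniteDimensional ℝ E] (a b : ℝ) (n : ℕ) :
    ∀ {F : Type u} [NormedAddCommGroup F] [NormedSpace ℝ F] {f : E × ℝ → F},
      ContDiff ℝ n f → ContDiff ℝ n (fun x => ∫ t in a..b, f (x, t)) := by
  induction n with
  | zero =>
    intro F _ _ f hf
    rw [Nat.cast_zero, contDiff_zero] at hf ⊢
    exact intervalIntegral.continuous_parametric_intervalIntegral_of_continuous'
      (f := fun x t => f (x, t)) hf a b
  | succ n ih =>
    intro F _ _ f hf
    have h1 : ContDiff ℝ 1 f := hf.of_le (by exact_mod_cast Nat.le_add_left 1 n)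
    rw [Nat.cast_succ, contDiff_succ_iff_hasFDerivAt]
    refine ⟨_, ?_, fun x => hasFDerivAt_parametric_intervalIntegral h1 a b x⟩
    refine ih (f := fun z => (fderiv ℝ f z).comp (ContinuousLinearMap.inl ℝ E ℝ)) ?_
    exact (hf.fderiv_right (by exact_mod_cast le_rfl)).clm_comp contDiff_const

end ParametricIntegral

/-! ### Smooth square roots and diagonalization of positive definite forms -/

section SquareRoot

/-- Squaring has derivative 2·id at 1, so it is locally invertible there. The anti-automorphism `τ`
stands for transposition: if `B` is fixed by `τ` and `g B` is its root near 1, then `τ (g B)` is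
also a root of `B` near 1, so the two agree. -/
theorem exists_contDiffAt_sqrt_one {X R : Type*} [NormedAddCommGroup X] [NormedSpace ℝ X]
    [NormedRing R] [NormedAlgebra ℝ R] [CompleteSpace R] (τ : R →L[ℝ] R)
    (hτ_mul : ∀ a b, τ (a * b) = τ b * τ a) (hτ_one : τ 1 = 1) {n : ℕ} {A : X → R} {x₀ : X}
    (hA : ContDiffAt ℝ n A x₀) (hτA : ∀ x, τ (A x) = A x) (h1 : A x₀ = 1) :
    ∃ T : X → R, ContDiffAt ℝ n T x₀ ∧ ∀ᶠ x in 𝓝 x₀, τ (T x) = T x ∧ T x * T x = A x := by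
  let s : R → R := fun T => T * T
  have hs : ContDiffAt ℝ (n + 1 : ℕ) s 1 := (contDiff_id.mul contDiff_id).contDiffAt
  let e : R ≃L[ℝ] R := ContinuousLinearEquiv.smulLeft (Units.mk0 (2 : ℝ) two_ne_zero)
  have hs' : HasFDerivAt s (e : R →L[ℝ] R) 1 := by
    have := (hasFDerivAt_id (𝕜 := ℝ) (1 : R)).mul' (hasFDerivAt_id (1 : R))
    refine this.congr_fderiv ?_
    ext B
    simp [e, two_smul, Units.smul_def]
  have hn : ((n + 1 : ℕ) : WithTop ℕ∞) ≠ 0 := by exact_mod_cast Nat.succ_ne_zero n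
  have hstrict := hs.hasStrictFDerivAt' hs' hn
  obtain ⟨g, hgdef⟩ : ∃ g, g = hs.localInverse hs' hn := ⟨_, rfl⟩
  have hs1 : s 1 = 1 := mul_one 1
  have hg1 : g 1 = 1 := by
    have := hs.localInverse_apply_image hs' hn
    rwa [hs1, ← hgdef] at this
  have hg : ContDiffAt ℝ (n + 1 : ℕ) g 1 := by
    have := hs.to_localInverse hs' hn
    rwa [hs1, ← hgdef] at this
  have hright : ∀ᶠ B in 𝓝 (1 : R), g B * g B = B := by
    have := hstrict.eventually_right_inverse
    rw [hs1] at this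
    rw [hgdef]
    exact this
  have hleft : ∀ᶠ B in 𝓝 (1 : R), g (B * B) = B := by
    rw [hgdef]
    exact hstrict.eventually_left_inverse
  have hAt : Tendsto A (𝓝 x₀) (𝓝 1) := h1 ▸ hA.continuousAt.tendsto
  have hgt : Tendsto (fun x => τ (g (A x))) (𝓝 x₀) (𝓝 1) := by
    have h2 : Tendsto g (𝓝 1) (𝓝 1) := by simpa only [hg1] using hg.continuousAt.tendsto
    have h3 : Tendsto τ (𝓝 1) (𝓝 1) := by simpa only [hτ_one] using τ.continuous.tendsto 1
    exact h3.comp (h2.comp hAt)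
  refine ⟨fun x => g (A x), ?_, ?_⟩
  · refine ContDiffAt.comp x₀ ?_ hA
    rw [h1]
    exact hg.of_le (by exact_mod_cast Nat.le_succ n)
  · filter_upwards [hAt.eventually hright, hgt.eventually hleft] with x hx1 hx2
    rw [← hτ_mul, hx1, hτA] at hx2
    exact ⟨hx2.symm, hx1⟩

attribute [local instance] Matrix.linftyOpNormedRing Matrix.linftyOpNormedAlgebra

theorem exists_contDiffAt_matrix_sqrt {X ι : Type*} [Fintype ι] [DecidableEq ι]
    [NormedAddCommGroup X] [NormedSpace ℝ X] {n : ℕ} {A : X → Matrix ι ι ℝ} {x₀ : X}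
    (hA : ∀ i j, ContDiffAt ℝ n (fun x => A x i j) x₀) (hsymm : ∀ x, (A x).IsSymm)
    (h1 : A x₀ = 1) :
    ∃ T : X → Matrix ι ι ℝ, (∀ i j, ContDiffAt ℝ n (fun x => T x i j) x₀) ∧
      ∀ᶠ x in 𝓝 x₀, (T x).IsSymm ∧ T x * T x = A x := by
  have hiff : ∀ A : X → Matrix ι ι ℝ,
      ContDiffAt ℝ n A x₀ ↔ ∀ i j, ContDiffAt ℝ n (fun x => A x i j) x₀ := fun A => by
    let e : Matrix ι ι ℝ ≃L[ℝ] (ι → ι → ℝ) :=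
      LinearEquiv.toContinuousLinearEquiv (LinearEquiv.refl ℝ (ι → ι → ℝ))
    refine (e.comp_contDiffAt_iff (f := A)).symm.trans (contDiffAt_pi.trans ?_)
    exact forall_congr' fun i => contDiffAt_pi
  obtain ⟨T, hT, hTA⟩ := exists_contDiffAt_sqrt_one
    (LinearMap.toContinuousLinearMap (Matrix.transposeLinearEquiv ι ι ℝ ℝ).toLinearMap)
    (fun a b => Matrix.transpose_mul a b) Matrix.transpose_one ((hiff A).2 hA)
    (fun x => (hsymm x).eq) h1
  exact ⟨T, (hiff T).1 hT, hTA⟩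

end SquareRoot

theorem exists_basis_orthonormal_of_posDef {E : Type*} [NormedAddCommGroup E] [NormedSpace ℝ E]
    [FiniteDimensional ℝ E] (B : E →L[ℝ] E →L[ℝ] ℝ) (hsymm : ∀ v w, B v w = B w v)
    (hpos : ∀ v, v ≠ 0 → 0 < B v v) :
    ∃ b : Module.Basis (Fin (Module.finrank ℝ E)) ℝ E, ∀ i j, B (b i) (b j) = if i = j then 1 else 0 := by
  let B' : LinearMap.BilinForm ℝ E :=
    LinearMap.mk₂ ℝ (fun v w => B v w) (by simp) (by simp) (by simp) (by simp)
  obtain ⟨v, hv⟩ := LinearMap.BilinForm.exists_orthogonal_basis (B := B')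
    ⟨fun v w => hsymm v w⟩
  have hv0 : ∀ i, 0 < B (v i) (v i) := fun i => hpos _ (v.ne_zero i)
  have hu : ∀ i, IsUnit ((√(B (v i) (v i)))⁻¹) := fun i =>
    (inv_ne_zero (Real.sqrt_ne_zero'.2 (hv0 i))).isUnit
  refine ⟨v.isUnitSMul hu, fun i j => ?_⟩
  rw [v.isUnitSMul_apply, v.isUnitSMul_apply]
  split_ifs with h
  · subst h
    have := Real.mul_self_sqrt (hv0 i).le
    have h0 := Real.sqrt_ne_zero'.2 (hv0 i)
    simp only [map_smul, _root_.smul_apply, smul_eq_mul]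
    field_simp
    rw [sq, this]
  · have : B (v i) (v j) = 0 := hv h
    simp [this]

/-- In a basis orthonormal for `A x₀`, the Gram matrix of `A x` is 1 at `x₀` and has a smooth
symmetric root `T x` nearby. If `c` denotes the coordinates of `v`, then `A x v v` is the sum of the
squares of the entries of `T x` applied to `c`. -/
theorem exists_contDiffAt_sum_sq_of_posDef {X E : Type*} [NormedAddCommGroup X] [NormedSpace ℝ X]
    [NormedAddCommGroup E] [NormedSpace ℝ E] [FiniteDimensional ℝ E] {n : ℕ}
    {A : X → E →L[ℝ] E →L[ℝ] ℝ} {x₀ : X} (hA : ContDiffAt ℝ n A x₀)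
    (hsymm : ∀ x v w, A x v w = A x w v) (hpos : ∀ v, v ≠ 0 → 0 < A x₀ v v) :
    ∃ l : Fin (Module.finrank ℝ E) → X → E →L[ℝ] ℝ, (∀ i, ContDiffAt ℝ n (l i) x₀) ∧
      ∀ᶠ x in 𝓝 x₀, ∀ v, A x v v = ∑ i, l i x v ^ 2 := by
  obtain ⟨b, hb⟩ := exists_basis_orthonormal_of_posDef (A x₀) (hsymm x₀) hpos
  obtain ⟨T, hT, hTA⟩ := exists_contDiffAt_matrix_sqrt (n := n) (x₀ := x₀)
    (A := fun x => Matrix.of fun i j => A x (b i) (b j))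
    (fun i j => (hA.clm_apply contDiffAt_const).clm_apply contDiffAt_const)
    (fun x => Matrix.IsSymm.ext fun i j => hsymm x _ _)
    (by ext i j; simp [hb, Matrix.one_apply])
  let c : Fin (Module.finrank ℝ E) → E →L[ℝ] ℝ := fun j => LinearMap.toContinuousLinearMap (b.coord j)
  refine ⟨fun i x => ∑ j, T x i j • c j, fun i => ?_, ?_⟩
  · exact ContDiffAt.sum fun j _ => (hT i j).smul contDiffAt_const
  · filter_upwards [hTA] with x ⟨hx1, hx2⟩ v
    have h1 : A x v v = ∑ i, ∑ j, c i v * c j v * A x (b i) (b j) := by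
      have hv : v = ∑ i, c i v • b i := (b.sum_repr v).symm
      conv_lhs => rw [hv]
      simp only [map_sum, map_smul, _root_.sum_apply, _root_.smul_apply,
        smul_eq_mul, Finset.mul_sum]
      rw [Finset.sum_comm]
      exact Finset.sum_congr rfl fun i _ => Finset.sum_congr rfl fun j _ => by ring
    have h2 : ∀ i j, A x (b i) (b j) = ∑ k, T x k i * T x k j := fun i j => by
      have := congrFun (congrFun hx2 i) j
      rw [Matrix.mul_apply, Matrix.of_apply] at this
      rw [← this]
      exact Finset.sum_congr rfl fun k _ => by rw [hx1.apply]
    simp only [h1, h2, _root_.sum_apply, _root_.smul_apply, smul_eq_mul,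
      sq, Finset.mul_sum, Finset.sum_mul]
    rw [Finset.sum_congr rfl fun i _ => Finset.sum_comm, Finset.sum_comm]
    refine Finset.sum_congr rfl fun k _ => Finset.sum_congr rfl fun i _ =>
      Finset.sum_congr rfl fun j _ => by ring

/-! ### Non-negative functions at their zeros and Taylor's formula of order two -/

section Euclidean

variable {E : Type} [NormedAddCommGroup E] [NormedSpace ℝ E]

theorem fderiv_eq_zero_of_nonneg {F : E → ℝ} (h0 : ∀ x, 0 ≤ F x) {x : E} (hx : F x = 0) :
    fderiv ℝ F x = 0 :=
  IsLocalMin.fderiv_eq_zero (Eventually.of_forall fun y => hx ▸ h0 y)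

theorem fderiv_fderiv_apply_self_nonneg {F : E → ℝ} (hF : ContDiff ℝ 2 F) (h0 : ∀ x, 0 ≤ F x)
    {x : E} (hx : F x = 0) (v : E) : 0 ≤ fderiv ℝ (fderiv ℝ F) x v v := by
  by_contra! hneg
  let g : ℝ → ℝ := fun t => F (x + t • v)
  have hl : ∀ t, HasDerivAt (fun t : ℝ => x + t • v) v t := fun t => by
    simpa using ((hasDerivAt_id t).smul_const v).const_add x
  have hg : ∀ t, HasDerivAt g (fderiv ℝ F (x + t • v) v) t := fun t =>
    ((hF.differentiable two_ne_zero _).hasFDerivAt).comp_hasDerivAt t (hl t)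
  have hF' : Differentiable ℝ (fderiv ℝ F) :=
    (hF.fderiv_right (m := 1) (by norm_num)).differentiable one_ne_zero
  have hg' : deriv g = fun t => fderiv ℝ F (x + t • v) v := funext fun t => (hg t).deriv
  have hg'' : deriv (deriv g) 0 = fderiv ℝ (fderiv ℝ F) x v v := by
    rw [hg']
    have h1 := ((hF' (x + (0 : ℝ) • v)).hasFDerivAt).comp_hasDerivAt (0 : ℝ) (hl 0)
    have h2 := (h1.clm_apply (hasDerivAt_const (0 : ℝ) v)).deriv
    simpa using h2
  have hg0 : g 0 = 0 := by simp [g, hx]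
  have hd0 : deriv g 0 = 0 := by simp [hg', fderiv_eq_zero_of_nonneg h0 hx]
  -- A negative second derivative makes 0 a local maximum of `g` as well as a minimum, so `g`
  -- vanishes near 0 and its second derivative is 0.
  have hmax := isLocalMax_of_deriv_deriv_neg (by rwa [hg'']) hd0 (hg 0).continuousAt
  have hz : g =ᶠ[𝓝 0] fun _ => 0 := hmax.mono fun t ht => le_antisymm (hg0 ▸ ht) (h0 _)
  have := hz.deriv.deriv_eq
  simp only [hg'', deriv_const'] at this
  simp [this] at hneg

theorem fderiv_fderiv_symm {F : E → ℝ} (hF : ContDiff ℝ 2 F) (x v w : E) :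
    fderiv ℝ (fderiv ℝ F) x v w = fderiv ℝ (fderiv ℝ F) x w v :=
  (hF.contDiffAt.isSymmSndFDerivAt (by simp)) v w

/-- Cauchy–Schwarz for a positive semidefinite form. -/
theorem apply_eq_zero_of_apply_self_eq_zero {H : E →L[ℝ] E →L[ℝ] ℝ}
    (hsymm : ∀ v w, H v w = H w v) (hnonneg : ∀ v, 0 ≤ H v v) {v : E} (hv : H v v = 0) :
    H v = 0 := by
  let B : LinearMap.BilinForm ℝ E :=
    LinearMap.mk₂ ℝ (fun v w => H v w) (by simp) (by simp) (by simp) (by simp)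
  ext w
  have : H v w ^ 2 ≤ H v v * H w w := B.apply_sq_le_of_symm hnonneg ⟨hsymm⟩ v w
  rw [hv, zero_mul] at this
  simpa using pow_eq_zero_iff two_ne_zero |>.1 (le_antisymm this (sq_nonneg _))

theorem contDiff_integral_one_sub_smul [FiniteDimensional ℝ E] {W : Type} [NormedAddCommGroup W]
    [NormedSpace ℝ W] {h : E → W} {n : ℕ} (hh : ContDiff ℝ n h) :
    ContDiff ℝ n fun z : E × E => ∫ t in (0 : ℝ)..1, (1 - t) • h (z.2 + t • (z.1 - z.2)) := by
  refine contDiff_parametric_intervalIntegral 0 1 n (f := fun q : (E × E) × ℝ =>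
    (1 - q.2) • h (q.1.2 + q.2 • (q.1.1 - q.1.2))) ?_
  exact (contDiff_const.sub contDiff_snd).smul (hh.comp (by fun_prop))

theorem integral_one_sub_smul_const {W : Type*} [NormedAddCommGroup W] [NormedSpace ℝ W]
    [CompleteSpace W] (c : W) : ∫ t in (0 : ℝ)..1, (1 - t) • c = (1 / 2 : ℝ) • c := by
  rw [intervalIntegral.integral_smul_const]
  congr 1
  rw [intervalIntegral.integral_sub (by simp) (by simp)]
  norm_num

/-- The remainder form in Taylor's formula of order two with centre `z.2` at the point `z.1`. -/
noncomputable def taylorForm (F : E → ℝ) (z : E × E) : E →L[ℝ] E →L[ℝ] ℝ :=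
  ∫ t in (0 : ℝ)..1, (1 - t) • fderiv ℝ (fderiv ℝ F) (z.2 + t • (z.1 - z.2))

theorem continuous_taylorForm_integrand {F : E → ℝ} (hF : ContDiff ℝ 2 F) (z : E × E) :
    Continuous fun t : ℝ => (1 - t) • fderiv ℝ (fderiv ℝ F) (z.2 + t • (z.1 - z.2)) := by
  have : Continuous (fderiv ℝ (fderiv ℝ F)) :=
    (hF.fderiv_right (m := 1) (by norm_num)).continuous_fderiv one_ne_zero
  fun_prop

theorem taylorForm_apply {F : E → ℝ} (hF : ContDiff ℝ 2 F) (z : E × E) (v w : E) :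
    taylorForm F z v w =
      ∫ t in (0 : ℝ)..1, (1 - t) * fderiv ℝ (fderiv ℝ F) (z.2 + t • (z.1 - z.2)) v w := by
  have hc := continuous_taylorForm_integrand hF z
  rw [taylorForm, ContinuousLinearMap.intervalIntegral_apply (hc.intervalIntegrable _ _),
    ContinuousLinearMap.intervalIntegral_apply
      ((hc.clm_apply continuous_const).intervalIntegrable _ _)]
  simp

theorem contDiff_taylorForm [FiniteDimensional ℝ E] {F : E → ℝ} {n : ℕ}
    (hF : ContDiff ℝ (n + 2 : ℕ) F) : ContDiff ℝ n (taylorForm F) := by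
  have h2 : ContDiff ℝ n (fderiv ℝ (fderiv ℝ F)) :=
    (hF.fderiv_right (m := (n + 1 : ℕ)) (by norm_cast)).fderiv_right (by norm_cast)
  exact contDiff_integral_one_sub_smul h2

theorem taylorForm_symm {F : E → ℝ} (hF : ContDiff ℝ 2 F) (z : E × E) (v w : E) :
    taylorForm F z v w = taylorForm F z w v := by
  simp only [taylorForm_apply hF, fderiv_fderiv_symm hF _ v w]

theorem taylorForm_diag {F : E → ℝ} (x : E) :
    taylorForm F (x, x) = (1 / 2 : ℝ) • fderiv ℝ (fderiv ℝ F) x := by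
  simp only [taylorForm, sub_self, smul_zero, add_zero]
  exact integral_one_sub_smul_const _

theorem eq_taylorForm_of_critical_zero {F : E → ℝ} (hF : ContDiff ℝ 2 F) {x y : E} (hy : F y = 0)
    (hy' : fderiv ℝ F y = 0) : F x = taylorForm F (x, y) (x - y) (x - y) := by
  have := map_add_eq_sum_add_integral_iteratedFDeriv (f := F) (x := y) (y := x - y) (n := 1)
    (fun t _ => hF.contDiffAt.of_le (by norm_num))
  rw [taylorForm_apply hF]
  simpa [Finset.sum_range_succ, hy, hy', iteratedFDeriv_two_apply] using this

/-- Semidefiniteness lets `H + Q` vanish on a diagonal pair only if both summands do. The sum serves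
as an invertible derivative in the construction of the retraction. -/
theorem exists_equiv_add_of_ker_eq [FiniteDimensional ℝ E] {H Q : E →L[ℝ] E →L[ℝ] ℝ}
    (hsymm : ∀ v w, H v w = H w v) (hnonneg : ∀ v, 0 ≤ H v v) (hQ : ∀ v, 0 ≤ Q v v)
    (hHQ : ∀ v, H v = 0 → Q v v = 0 → v = 0) :
    ∃ e : E ≃L[ℝ] (E →L[ℝ] ℝ), (e : E →L[ℝ] (E →L[ℝ] ℝ)) = H + Q := by
  have hinj : Function.Injective (H + Q) := by
    rw [injective_iff_map_eq_zero]
    intro v hv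
    have h1 : H v v + Q v v = 0 := DFunLike.congr_fun hv v
    have h3 : H v v = 0 := by linarith [hnonneg v, hQ v]
    exact hHQ v (apply_eq_zero_of_apply_self_eq_zero hsymm hnonneg h3) (by linarith)
  have hfr : Module.finrank ℝ E = Module.finrank ℝ (E →L[ℝ] ℝ) := by
    rw [← LinearMap.toContinuousLinearMap.finrank_eq]
    exact Subspace.dual_finrank_eq.symm
  exact ⟨(LinearEquiv.ofInjectiveOfFinrankEq (H + Q).toLinearMap hinj hfr).toContinuousLinearEquiv,
    by ext1 v; rfl⟩

end Euclidean

/-! ### Decomposition near a zero in Euclidean space -/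

section LocalDecomposition

variable {d d₀ : ℕ}

local notation "𝔼" => EuclideanSpace ℝ (Fin d)

/-- Differentiating dF ∘ φ = 0 at 0 gives one inclusion; the rank condition makes the dimensions
equal. -/
theorem range_eq_ker_hessian {F : 𝔼 → ℝ} (hF : ContDiff ℝ 2 F)
    (h0 : ∀ x, 0 ≤ F x) {φ : EuclideanSpace ℝ (Fin d₀) → 𝔼}
    {φ' : EuclideanSpace ℝ (Fin d₀) →L[ℝ] 𝔼} (hφ : HasStrictFDerivAt φ φ' 0)
    (hφ' : Function.Injective φ') (hzero : ∀ᶠ w in 𝓝 0, F (φ w) = 0) (hd : d₀ ≤ d)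
    (hrank : Module.finrank ℝ (fderiv ℝ (fderiv ℝ F) (φ 0)).range = d - d₀) :
    φ'.range = (fderiv ℝ (fderiv ℝ F) (φ 0)).ker := by
  have hF' : Differentiable ℝ (fderiv ℝ F) :=
    (hF.fderiv_right (m := 1) (by norm_num)).differentiable one_ne_zero
  have h1 : (fderiv ℝ (fderiv ℝ F) (φ 0)).comp φ' = 0 := by
    refine ((hF' (φ 0)).hasFDerivAt.comp 0 hφ.hasFDerivAt).unique ?_
    refine (hasFDerivAt_const (0 : 𝔼 →L[ℝ] ℝ) (0 : EuclideanSpace ℝ (Fin d₀))).congr_of_eventuallyEq ?_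
    exact hzero.mono fun w hw => fderiv_eq_zero_of_nonneg h0 hw
  refine Submodule.eq_of_le_of_finrank_eq ?_ ?_
  · rintro _ ⟨w, rfl⟩
    exact DFunLike.congr_fun h1 w
  · have h2 := LinearMap.finrank_range_add_finrank_ker (fderiv ℝ (fderiv ℝ F) (φ 0)).toLinearMap
    have h3 := LinearMap.finrank_range_of_inj (f := φ'.toLinearMap) hφ'
    rw [finrank_euclideanSpace_fin] at h2 h3
    refine h3.trans ?_
    change Module.finrank ℝ (fderiv ℝ (fderiv ℝ F) (φ 0)).range + _ = _ at h2
    change _ = Module.finrank ℝ (LinearMap.ker (fderiv ℝ (fderiv ℝ F) (φ 0)).toLinearMap)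
    omega

theorem map_nhds_clm_comp_of_surjective {E₀ E W : Type*} [NormedAddCommGroup E₀] [NormedSpace ℝ E₀]
    [CompleteSpace E₀] [NormedAddCommGroup E] [NormedSpace ℝ E] [NormedAddCommGroup W]
    [NormedSpace ℝ W] [CompleteSpace W] {φ : E₀ → E} {φ' : E₀ →L[ℝ] E} (p : E →L[ℝ] W)
    (hφ : HasStrictFDerivAt φ φ' 0) (hp : ∀ y, ∃ w, p (φ' w) = y) :
    map (fun w => p (φ w - φ 0)) (𝓝 0) = 𝓝 0 := by
  have hψ : HasStrictFDerivAt (fun w => p (φ w - φ 0)) (p.comp φ') 0 :=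
    p.hasStrictFDerivAt.comp 0 (hφ.sub_const (φ 0))
  have := hψ.map_nhds_eq_of_surj (LinearMap.range_eq_top.2 hp)
  simpa using this

/-- The class `n + 1` ensures that `Φ` is C¹ even for `n = 0`, as the inverse function theorem
requires. -/
theorem exists_local_leftInverse {V W : Type*} [NormedAddCommGroup V] [NormedSpace ℝ V]
    [CompleteSpace V] [NormedAddCommGroup W] [NormedSpace ℝ W] {n : ℕ} {Φ : V → W} {x₀ : V}
    (hΦ : ContDiffAt ℝ (n + 1 : ℕ) Φ x₀) (e : V ≃L[ℝ] W) (he : HasFDerivAt Φ (e : V →L[ℝ] W) x₀) :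
    ∃ Ψ : W → V, ContDiffAt ℝ n Ψ (Φ x₀) ∧ Ψ (Φ x₀) = x₀ ∧ ∀ᶠ x in 𝓝 x₀, Ψ (Φ x) = x := by
  have hn : ((n + 1 : ℕ) : WithTop ℕ∞) ≠ 0 := by exact_mod_cast Nat.succ_ne_zero n
  exact ⟨hΦ.localInverse he hn, (hΦ.to_localInverse he hn).of_le (by exact_mod_cast Nat.le_succ n),
    hΦ.localInverse_apply_image he hn, (hΦ.hasStrictFDerivAt' he hn).eventually_left_inverse⟩

/-- The positive semidefinite form `⟪π v, π w⟫`, where `π` is the orthogonal projection to `K`. -/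
noncomputable def projForm (K : Submodule ℝ 𝔼) : 𝔼 →L[ℝ] 𝔼 →L[ℝ] ℝ :=
  (innerSL ℝ).bilinearComp K.starProjection K.starProjection

theorem projForm_apply (K : Submodule ℝ 𝔼) (v w : 𝔼) :
    projForm K v w = inner ℝ (K.starProjection v) (K.starProjection w) := rfl

theorem projForm_self_nonneg (K : Submodule ℝ 𝔼) (v : 𝔼) : 0 ≤ projForm K v v := by
  rw [projForm_apply]
  exact real_inner_self_nonneg

theorem eq_zero_of_projForm_self {K : Submodule ℝ 𝔼} {v : 𝔼} (hv : v ∈ K)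
    (h : projForm K v v = 0) : v = 0 := by
  rw [projForm_apply, Submodule.starProjection_eq_self_iff.2 hv] at h
  exact inner_self_eq_zero.1 h

/-- The projection of `φ` to `K` has surjective derivative at 0, so the image of any neighbourhood
of 0 is a neighbourhood of the projected base point: points of the parametrized zero set lie over
every `x` near `φ 0`. -/
theorem eventually_exists_starProjection_eq {φ : EuclideanSpace ℝ (Fin d₀) → 𝔼}
    {φ' : EuclideanSpace ℝ (Fin d₀) →L[ℝ] 𝔼} (hφ : HasStrictFDerivAt φ φ' 0)
    {K : Submodule ℝ 𝔼} (hrange : φ'.range = K) {s : EuclideanSpace ℝ (Fin d₀) → Prop}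
    (hs : ∀ᶠ w in 𝓝 0, s w) :
    ∀ᶠ x in 𝓝 (φ 0), ∃ w, s w ∧ K.starProjection (φ w - φ 0) = K.starProjection (x - φ 0) := by
  have hmap : map (fun w => K.orthogonalProjectionOnto (φ w - φ 0)) (𝓝 0) = 𝓝 0 := by
    refine map_nhds_clm_comp_of_surjective _ hφ fun k => ?_
    obtain ⟨w, hw⟩ : (k : 𝔼) ∈ φ'.range := hrange ▸ k.2
    refine ⟨w, ?_⟩
    rw [show φ' w = k from hw]
    exact Submodule.orthogonalProjectionOnto_mem_subspace_eq_self k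
  have hgood : ∀ᶠ k in 𝓝 (0 : K), ∃ w, s w ∧ K.orthogonalProjectionOnto (φ w - φ 0) = k := by
    rw [← hmap]
    exact eventually_map.2 (hs.mono fun w hw => ⟨w, hw, rfl⟩)
  have h1 : Tendsto (fun x => K.orthogonalProjectionOnto (x - φ 0)) (𝓝 (φ 0)) (𝓝 0) := by
    have : Continuous fun x => K.orthogonalProjectionOnto (x - φ 0) := by fun_prop
    simpa using this.tendsto (φ 0)
  exact (h1.eventually hgood).mono fun x ⟨w, hw, h⟩ => ⟨w, hw, congrArg Subtype.val h⟩

/-- The retraction onto the zero set of `F` near `φ 0` along the directions orthogonal to the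
kernel of the Hessian. -/
theorem exists_contDiffAt_retraction {n : ℕ} {F : 𝔼 → ℝ} (hF : ContDiff ℝ (n + 2 : ℕ) F)
    (h0 : ∀ x, 0 ≤ F x) {φ : EuclideanSpace ℝ (Fin d₀) → 𝔼}
    {φ' : EuclideanSpace ℝ (Fin d₀) →L[ℝ] 𝔼} (hφ : HasStrictFDerivAt φ φ' 0)
    (hzero : ∀ᶠ w in 𝓝 0, F (φ w) = 0) {K : Submodule ℝ 𝔼}
    (hK : (fderiv ℝ (fderiv ℝ F) (φ 0)).ker = K) (hrange : φ'.range = K) :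
    ∃ P : 𝔼 → 𝔼, ContDiffAt ℝ n P (φ 0) ∧ P (φ 0) = φ 0 ∧
      ∀ᶠ x in 𝓝 (φ 0), F (P x) = 0 ∧ K.starProjection (x - P x) = 0 := by
  have hF2 : ContDiff ℝ 2 F := hF.of_le (by exact_mod_cast Nat.le_add_left 2 n)
  have hφ0 : F (φ 0) = 0 := hzero.self_of_nhds
  obtain ⟨e, he⟩ := exists_equiv_add_of_ker_eq (Q := projForm K) (fderiv_fderiv_symm hF2 (φ 0))
    (fderiv_fderiv_apply_self_nonneg hF2 h0 hφ0) (projForm_self_nonneg K)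
    (fun v hv => eq_zero_of_projForm_self (hK ▸ hv))
  have hDF : ContDiff ℝ (n + 1 : ℕ) (fderiv ℝ F) := hF.fderiv_right (by norm_cast)
  have hn : ((n + 1 : ℕ) : WithTop ℕ∞) ≠ 0 := by exact_mod_cast Nat.succ_ne_zero n
  have hQ : ContDiff ℝ (n + 1 : ℕ) fun x => projForm K (x - φ 0) :=
    (projForm K).contDiff.comp (contDiff_id.sub contDiff_const)
  have hQ' : HasFDerivAt (fun x => projForm K (x - φ 0)) (projForm K) (φ 0) := by
    simpa only [map_sub] using (projForm K).hasFDerivAt.sub_const (projForm K (φ 0))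
  have hΦ' : HasFDerivAt (fun x => fderiv ℝ F x + projForm K (x - φ 0))
      (e : 𝔼 →L[ℝ] (𝔼 →L[ℝ] ℝ)) (φ 0) := by
    rw [he]
    exact ((hDF.differentiable hn (φ 0)).hasFDerivAt).add hQ'
  have hΦ : ContDiffAt ℝ (n + 1 : ℕ) (fun x => fderiv ℝ F x + projForm K (x - φ 0)) (φ 0) :=
    (hDF.add hQ).contDiffAt
  obtain ⟨Ψ, hΨ, hΨ0, hleft⟩ := exists_local_leftInverse hΦ e hΦ'
  simp only [sub_self, map_zero, add_zero, fderiv_eq_zero_of_nonneg h0 hφ0] at hΨ hΨ0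
  -- At a zero y the differential drops out of the inverted map, whose value is then `projForm K (y
  -- - φ 0)`. So `Ψ` returns the zero `φ w` having the same projection to `K` as `x`.
  refine ⟨fun x => Ψ (projForm K (x - φ 0)), ?_, by simp [hΨ0], ?_⟩
  · refine ContDiffAt.comp (φ 0) ?_ (hQ.contDiffAt.of_le (by exact_mod_cast Nat.le_succ n))
    rwa [sub_self, map_zero]
  · filter_upwards [eventually_exists_starProjection_eq hφ hrange
      (hzero.and (hφ.continuousAt.eventually hleft))] with x ⟨w, ⟨hw1, hw2⟩, hw3⟩
    have h4 : fderiv ℝ F (φ w) + projForm K (φ w - φ 0) = projForm K (x - φ 0) := by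
      ext v
      rw [fderiv_eq_zero_of_nonneg h0 hw1, zero_add, projForm_apply, projForm_apply, hw3]
    rw [← h4, hw2]
    refine ⟨hw1, ?_⟩
    rw [← sub_sub_sub_cancel_right x (φ w) (φ 0), map_sub, hw3, sub_self]

theorem exists_contDiffAt_sum_sq_of_contDiff {n : ℕ} {F : 𝔼 → ℝ} (hF : ContDiff ℝ (n + 2 : ℕ) F)
    (h0 : ∀ x, 0 ≤ F x) {φ : EuclideanSpace ℝ (Fin d₀) → 𝔼}
    {φ' : EuclideanSpace ℝ (Fin d₀) →L[ℝ] 𝔼} (hφ : HasStrictFDerivAt φ φ' 0)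
    (hφ' : Function.Injective φ') (hzero : ∀ᶠ w in 𝓝 0, F (φ w) = 0) (hd : d₀ ≤ d)
    (hrank : Module.finrank ℝ (fderiv ℝ (fderiv ℝ F) (φ 0)).range = d - d₀) :
    ∃ g : Fin d → 𝔼 → ℝ, (∀ i, ContDiffAt ℝ n (g i) (φ 0)) ∧
      ∀ᶠ x in 𝓝 (φ 0), F x = ∑ i, g i x ^ 2 := by
  have hF2 : ContDiff ℝ 2 F := hF.of_le (by exact_mod_cast Nat.le_add_left 2 n)
  have hrange := range_eq_ker_hessian hF2 h0 hφ hφ' hzero hd hrank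
  obtain ⟨K, hK⟩ : ∃ K, (fderiv ℝ (fderiv ℝ F) (φ 0)).ker = K := ⟨_, rfl⟩
  rw [hK] at hrange
  obtain ⟨P, hP, hP0, hPz⟩ := exists_contDiffAt_retraction hF h0 hφ hzero hK hrange
  have hHsymm := fderiv_fderiv_symm hF2 (φ 0)
  have hHnonneg := fderiv_fderiv_apply_self_nonneg hF2 h0 hzero.self_of_nhds
  obtain ⟨l, hl, hlA⟩ := exists_contDiffAt_sum_sq_of_posDef (n := n) (x₀ := φ 0)
    -- The added form gives definiteness on the kernel of the Hessian and is free of charge, since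
    -- the projection of `x - P x` to `K` is 0.
    (A := fun x => taylorForm F (x, P x) + projForm K)
    (((contDiff_taylorForm hF).contDiffAt.comp (φ 0) (contDiffAt_id.prodMk hP)).add
      contDiffAt_const)
    (fun x v w => by
      simp only [_root_.add_apply, projForm_apply, taylorForm_symm hF2 _ v w, real_inner_comm])
    (fun v hv => by
      simp only [_root_.add_apply, hP0, taylorForm_diag, _root_.smul_apply, smul_eq_mul]
      have h1 := hHnonneg v
      have h2 := projForm_self_nonneg K v
      refine lt_of_le_of_ne (by positivity) fun h => hv ?_
      have h3 : fderiv ℝ (fderiv ℝ F) (φ 0) v v = 0 := by linarith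
      refine eq_zero_of_projForm_self (K := K) ?_ (by linarith)
      exact hK ▸ apply_eq_zero_of_apply_self_eq_zero hHsymm hHnonneg h3)
  let c : Fin d ≃ Fin (Module.finrank ℝ 𝔼) := finCongr finrank_euclideanSpace_fin.symm
  refine ⟨fun i x => l (c i) x (x - P x), fun i => (hl _).clm_apply (contDiffAt_id.sub hP), ?_⟩
  filter_upwards [hlA, hPz] with x hx ⟨hx1, hx2⟩
  rw [c.sum_comp fun i => l i x (x - P x) ^ 2, ← hx, eq_taylorForm_of_critical_zero hF2 hx1
    (fderiv_eq_zero_of_nonneg h0 hx1), _root_.add_apply, _root_.add_apply, projForm_apply, hx2]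
  simp

/-- A function read in a chart is smooth only locally, while Taylor's formula is used above for
globally smooth functions; a cutoff bridges the two. -/
theorem exists_contDiff_eventuallyEq_nonneg {n : ℕ} {F : 𝔼 → ℝ} {x₀ : 𝔼}
    (hF : ContDiffAt ℝ n F x₀) (h0 : ∀ x, 0 ≤ F x) :
    ∃ G : 𝔼 → ℝ, ContDiff ℝ n G ∧ (∀ x, 0 ≤ G x) ∧ G =ᶠ[𝓝 x₀] F := by
  obtain ⟨u, hu, hFu⟩ := hF.contDiffOn le_rfl (by simp)
  obtain ⟨r, hr, hru⟩ := Metric.mem_nhds_iff.1 hu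
  let χ : ContDiffBump x₀ := ⟨r / 4, r / 2, by positivity, by linarith⟩
  refine ⟨fun x => χ x * F x, ?_, fun x => mul_nonneg χ.nonneg (h0 x), ?_⟩
  · refine contDiff_iff_contDiffAt.2 fun x => ?_
    by_cases hx : x ∈ Metric.ball x₀ r
    · exact χ.contDiff.contDiffAt.mul
        ((hFu.mono hru).contDiffAt (Metric.isOpen_ball.mem_nhds hx))
    · have hx' : x ∉ tsupport χ := by
        rw [χ.tsupport_eq, Metric.mem_closedBall]
        rw [Metric.mem_ball] at hx
        change ¬ dist x x₀ ≤ r / 2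
        linarith
      have : (fun x => χ x * F x) =ᶠ[𝓝 x] fun _ => 0 := by
        filter_upwards [notMem_tsupport_iff_eventuallyEq.1 hx'] with y hy
        simp [hy]
      exact contDiffAt_const.congr_of_eventuallyEq this
  · filter_upwards [χ.eventuallyEq_one] with x hx
    simp [hx]

theorem exists_contDiffAt_sum_sq {n : ℕ} {F : 𝔼 → ℝ} {φ : EuclideanSpace ℝ (Fin d₀) → 𝔼}
    {φ' : EuclideanSpace ℝ (Fin d₀) →L[ℝ] 𝔼} (hF : ContDiffAt ℝ (n + 2 : ℕ) F (φ 0))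
    (h0 : ∀ x, 0 ≤ F x) (hφ : HasStrictFDerivAt φ φ' 0)
    (hφ' : Function.Injective φ') (hzero : ∀ᶠ w in 𝓝 0, F (φ w) = 0) (hd : d₀ ≤ d)
    (hrank : Module.finrank ℝ (fderiv ℝ (fderiv ℝ F) (φ 0)).range = d - d₀) :
    ∃ g : Fin d → 𝔼 → ℝ, (∀ i, ContDiffAt ℝ n (g i) (φ 0)) ∧
      ∀ᶠ x in 𝓝 (φ 0), F x = ∑ i, g i x ^ 2 := by
  obtain ⟨G, hG, hG0, hGF⟩ := exists_contDiff_eventuallyEq_nonneg hF h0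
  obtain ⟨g, hg, hgG⟩ := exists_contDiffAt_sum_sq_of_contDiff hG hG0 hφ hφ'
    (by filter_upwards [hzero, hφ.continuousAt.eventually hGF] with w h1 h2; rw [h2, h1]) hd
    (by rw [hGF.fderiv.fderiv_eq, hrank])
  exact ⟨g, hg, by filter_upwards [hgG, hGF] with x h1 h2; rw [← h2, h1]⟩

/-- A zero of a non-negative function with positive definite Hessian is isolated. -/
theorem eventually_ne_zero_of_posDef {F : 𝔼 → ℝ} {x₀ : 𝔼} (hF : ContDiffAt ℝ 2 F x₀)
    (h0 : ∀ x, 0 ≤ F x) (hpos : ∀ ξ, ξ ≠ 0 → 0 < fderiv ℝ (fderiv ℝ F) x₀ ξ ξ) :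
    ∀ᶠ x in 𝓝[≠] x₀, F x ≠ 0 := by
  have hF' : DifferentiableAt ℝ (fderiv ℝ F) x₀ :=
    (hF.fderiv_right (m := 1) (by norm_num)).differentiableAt one_ne_zero
  have hinj : (fderiv ℝ (fderiv ℝ F) x₀).ker = ⊥ := by
    refine (Submodule.eq_bot_iff _).2 fun v hv => by_contra fun h => (hpos v h).ne' ?_
    rw [show fderiv ℝ (fderiv ℝ F) x₀ v = 0 from hv]
    rfl
  obtain ⟨C, -, hC⟩ :=
    LinearMap.exists_antilipschitzWith (fderiv ℝ (fderiv ℝ F) x₀).toLinearMap hinj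
  -- The differential has an injective derivative at `x₀`, so it is nonzero at the other nearby
  -- points, whereas it vanishes at every zero.
  refine (hF'.hasFDerivAt.eventually_ne (c := 0) ⟨C, hC⟩).mono fun x hx h => hx ?_
  exact fderiv_eq_zero_of_nonneg h0 h

end LocalDecomposition

/-! ### Transfer to the manifold and covers by bump functions -/

section ManifoldLocal

variable {d : ℕ} {M : Type*} [TopologicalSpace M] [ChartedSpace (EuclideanSpace ℝ (Fin d)) M]

local notation "𝔼" => EuclideanSpace ℝ (Fin d)

theorem contDiffAt_comp_chartAt_symm {q : ℕ} [IsManifold (𝓡 d) q M] {f : M → ℝ}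
    (hf : ContMDiff (𝓡 d) 𝓘(ℝ, ℝ) q f) (x : M) :
    ContDiffAt ℝ q (f ∘ (chartAt 𝔼 x).symm) (chartAt 𝔼 x x) := by
  have h := hf.comp_contMDiffOn (contMDiffOn_chart_symm (I := 𝓡 d) (n := q) (x := x))
  exact (contMDiffOn_iff_contDiffOn.1 h).contDiffAt
    ((chartAt 𝔼 x).open_target.mem_nhds (mem_chart_target 𝔼 x))

theorem NormalHessianConditionAt.exists_sum_sq {n : ℕ} [IsManifold (𝓡 d) (n + 2 : ℕ) M]
    {f : M → ℝ} (hf : ContMDiff (𝓡 d) 𝓘(ℝ, ℝ) (n + 2 : ℕ) f) (h0 : ∀ x, 0 ≤ f x) {x : M}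
    (h : NormalHessianConditionAt d f x) :
    ∃ (U : Set M) (g : Fin d → M → ℝ), IsOpen U ∧ x ∈ U ∧
      (∀ i, ContMDiffOn (𝓡 d) 𝓘(ℝ, ℝ) n (g i) U) ∧ ∀ y ∈ U, f y = ∑ i, g i y ^ 2 := by
  obtain ⟨d₀, hd, k, N, hk, hN, hxN, hNf, hrank⟩ := h
  have : IsManifold (𝓡 d) n M :=
    IsManifold.of_le (n := (n + 2 : ℕ)) (by exact_mod_cast Nat.le_add_right n 2)
  have := hN.isManifold
  obtain ⟨V, φ, hφ⟩ := hN.image_chart x hxN (chartAt 𝔼 x) (IsManifold.chart_mem_maximalAtlas x)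
    (mem_chart_source 𝔼 x) (chartAt 𝔼 x x) (mem_image_of_mem _ ⟨mem_chart_source 𝔼 x, hxN⟩)
  have hφ0 : φ 0 = chartAt 𝔼 x x := hφ.map_zero
  have hV : V ∈ 𝓝 (0 : EuclideanSpace ℝ (Fin d₀)) := hφ.isOpen.mem_nhds hφ.zero_mem
  -- Only strict differentiability of the parametrization at 0 is needed, hence `1 ≤ k` suffices.
  have hφs : HasStrictFDerivAt φ (fderiv ℝ φ 0) 0 :=
    (hφ.contDiffOn.contDiffAt hV).hasStrictFDerivAt (by exact_mod_cast Nat.one_le_iff_ne_zero.1 hk)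
  have hzero : ∀ᶠ w in 𝓝 0, (f ∘ (chartAt 𝔼 x).symm) (φ w) = 0 := by
    obtain ⟨W, -, hW⟩ := hφ.image_eq
    filter_upwards [hV] with w hw
    obtain ⟨y, ⟨hy, hyN⟩, hyw⟩ := (hW.subset (mem_image_of_mem φ hw)).1
    rw [← hyw, Function.comp_apply, (chartAt 𝔼 x).left_inv hy]
    exact hNf hyN
  have hF := contDiffAt_comp_chartAt_symm hf x
  have hrank' : Module.finrank ℝ
      (fderiv ℝ (fderiv ℝ (f ∘ (chartAt 𝔼 x).symm)) (φ 0)).range = d - d₀ := by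
    rw [hφ0]
    exact hrank
  rw [← hφ0] at hF
  obtain ⟨g, hg, hsum⟩ := exists_contDiffAt_sum_sq hF (fun _ => h0 _) hφs hφ.injective_fderiv hzero
    hd hrank'
  rw [hφ0] at hg hsum
  have hgM : ∀ᶠ y in 𝓝 x, ∀ i, ContMDiffAt (𝓡 d) 𝓘(ℝ, ℝ) n (fun z => g i (chartAt 𝔼 x z)) y := by
    refine eventually_all.2 fun i => (contMDiffAt_iff_contMDiffAt_nhds (by simp)).1 ?_
    exact (hg i).contMDiffAt.comp x
      ((contMDiffOn_chart (I := 𝓡 d) (n := n) (x := x)).contMDiffAt (chart_source_mem_nhds 𝔼 x))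
  have hsumM : ∀ᶠ y in 𝓝 x, f y = ∑ i, g i (chartAt 𝔼 x y) ^ 2 := by
    filter_upwards [((chartAt 𝔼 x).continuousAt (mem_chart_source 𝔼 x)).eventually hsum,
      chart_source_mem_nhds 𝔼 x] with y hy hys
    rw [← hy, Function.comp_apply, (chartAt 𝔼 x).left_inv hys]
  obtain ⟨U, hU, hUo, hxU⟩ := mem_nhds_iff.1 (hgM.and hsumM)
  exact ⟨U, fun i z => g i (chartAt 𝔼 x z), hUo, hxU,
    fun i y hy => ((hU hy).1 i).contMDiffWithinAt, fun y hy => (hU hy).2⟩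

theorem StrictHessianCondition.eventually_ne_zero {n : ℕ} [IsManifold (𝓡 d) (n + 2 : ℕ) M]
    {f : M → ℝ} (hf : ContMDiff (𝓡 d) 𝓘(ℝ, ℝ) (n + 2 : ℕ) f) (h0 : ∀ x, 0 ≤ f x)
    (h : StrictHessianCondition d f) {x : M} (hx : x ∈ zeros f) : ∀ᶠ y in 𝓝[≠] x, f y ≠ 0 := by
  have hF := (contDiffAt_comp_chartAt_symm hf x).of_le
    (show (2 : WithTop ℕ∞) ≤ (n + 2 : ℕ) by exact_mod_cast Nat.le_add_left 2 n)
  have h1 := eventually_nhdsWithin_iff.1 (eventually_ne_zero_of_posDef hF (fun _ => h0 _) (h x hx))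
  rw [eventually_nhdsWithin_iff]
  filter_upwards [((chartAt 𝔼 x).continuousAt (mem_chart_source 𝔼 x)).eventually h1,
    chart_source_mem_nhds 𝔼 x] with y hy hys hyx
  have := hy fun h => hyx ((chartAt 𝔼 x).injOn hys (mem_chart_source 𝔼 x) h)
  rwa [Function.comp_apply, (chartAt 𝔼 x).left_inv hys] at this

theorem contMDiff_smoothBumpFunction {q : ℕ} [T2Space M] [IsManifold (𝓡 d) q M] {c : M}
    (ψ : SmoothBumpFunction (𝓡 d) c) : ContMDiff (𝓡 d) 𝓘(ℝ, ℝ) q ψ := by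
  refine contMDiff_of_tsupport fun x hx => ?_
  have hx' : x ∈ (chartAt 𝔼 c).source := ψ.tsupport_subset_chartAt_source hx
  refine ContMDiffAt.congr_of_eventuallyEq ?_ <| ψ.eqOn_source.eventuallyEq_of_mem <|
    (chartAt 𝔼 c).open_source.mem_nhds hx'
  exact ψ.contDiffAt.contMDiffAt.comp _ (contMDiffAt_extChartAt' hx')

theorem exists_bump_cover [T2Space M] [SecondCountableTopology M] (q : ℕ) [IsManifold (𝓡 d) q M]
    {s : Set M} (hs : IsClosed s) {U : M → Set M} (hU : ∀ x ∈ s, U x ∈ 𝓝 x) :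
    ∃ (ι : Type) (c : ι → M) (ψ : ι → M → ℝ), Countable ι ∧ (∀ i, c i ∈ s) ∧
      (∀ i, ContMDiff (𝓡 d) 𝓘(ℝ, ℝ) q (ψ i)) ∧ (∀ i x, 0 ≤ ψ i x) ∧
      (LocallyFinite fun i => tsupport (ψ i)) ∧ (∀ i, tsupport (ψ i) ⊆ U (c i)) ∧
      (∀ i, c i ∈ tsupport (ψ i)) ∧ ∀ x ∈ s, ∃ i, ψ i =ᶠ[𝓝 x] 1 := by
  have : LocallyCompactSpace M := ChartedSpace.locallyCompactSpace 𝔼 M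
  obtain ⟨ι, ψ, hψ⟩ := SmoothBumpCovering.exists_isSubordinate (𝓡 d) hs hU
  -- A locally finite family of nonempty sets in a second-countable space is countable; the index
  -- set can therefore be moved to `Type`.
  have hcount : Countable ι := countable_univ_iff.1
    (ψ.locallyFinite.countable_univ fun i => (ψ i).nonempty_support)
  let e := equivShrink.{0} ι
  refine ⟨Shrink.{0} ι, fun i => ψ.c (e.symm i), fun i => ψ (e.symm i), e.symm.injective.countable,
    fun i => ψ.c_mem' _, fun i => contMDiff_smoothBumpFunction _, fun i x => (ψ _).nonneg,
    ψ.locallyFinite.closure.comp_injective e.symm.injective, fun i => hψ _,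
    fun i => subset_closure (ψ _).c_mem_support, fun x hx => ⟨e (ψ.ind x hx), ?_⟩⟩
  have : ∀ j, j = ψ.ind x hx → ψ j =ᶠ[𝓝 x] 1 := by
    rintro _ rfl
    exact ψ.eventuallyEq_one x hx
  exact this _ (e.symm_apply_apply _)

end ManifoldLocal

/-! ### Gluing the local decompositions -/

section Gluing

variable {d : ℕ} {M : Type*} [TopologicalSpace M] [ChartedSpace (EuclideanSpace ℝ (Fin d)) M]

theorem contMDiff_mul_of_tsupport_subset {q : ℕ} {ψ g : M → ℝ} {U : Set M}
    (hψ : ContMDiff (𝓡 d) 𝓘(ℝ, ℝ) q ψ) (hU : IsOpen U) (hg : ContMDiffOn (𝓡 d) 𝓘(ℝ, ℝ) q g U)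
    (hψU : tsupport ψ ⊆ U) : ContMDiff (𝓡 d) 𝓘(ℝ, ℝ) q fun x => ψ x * g x := by
  refine contMDiff_of_tsupport fun x hx => ?_
  have hxU : x ∈ U := hψU (tsupport_mul_subset_left hx)
  exact hψ.contMDiffAt.mul (hg.contMDiffAt (hU.mem_nhds hxU))

/-- A decomposition of `s * f` into squares, with `1 ≤ s` near the zeros of `f`, yields a
decomposition of `f` with one more summand. -/
theorem exists_isSumOfSquaresOf_of_near_zeros {q : ℕ} {f s : M → ℝ}
    (hf : ContMDiff (𝓡 d) 𝓘(ℝ, ℝ) q f) (h0 : ∀ x, 0 ≤ f x) (hs : ContMDiff (𝓡 d) 𝓘(ℝ, ℝ) q s)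
    (hs0 : ∀ x, 0 ≤ s x) (hs1 : ∀ x ∈ zeros f, ∀ᶠ y in 𝓝 x, 1 ≤ s y) {ι : Type} {h : ι → M → ℝ}
    (hh : ∀ i, ContMDiff (𝓡 d) 𝓘(ℝ, ℝ) q (h i)) (hfin : LocallyFinite fun i => tsupport (h i))
    (hsum : ∀ x, HasSum (fun i => h i x ^ 2) (s x * f x)) :
    ∃ g : ι ⊕ Unit → M → ℝ, IsSumOfSquaresOf d q f g := by
  -- `χ` is 0 where `s ≥ 1`, in particular near the zeros, and 1 where `s = 0`. Thus `σ` is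
  -- positive, and f = (s f + (χ √f)²) / σ.
  let χ : M → ℝ := fun x => Real.smoothTransition (1 - s x)
  have hχ : ContMDiff (𝓡 d) 𝓘(ℝ, ℝ) q χ :=
    Real.smoothTransition.contDiff.comp_contMDiff (contMDiff_const.sub hs)
  let σ : M → ℝ := fun x => s x + χ x ^ 2
  have hσ : ContMDiff (𝓡 d) 𝓘(ℝ, ℝ) q σ := hs.add (hχ.pow 2)
  have hσ0 : ∀ x, 0 < σ x := fun x => by
    rcases (hs0 x).eq_or_lt with h | h
    · simp [σ, χ, ← h]
    · have := sq_nonneg (χ x)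
      simp only [σ]
      linarith
  have hinv : ContMDiff (𝓡 d) 𝓘(ℝ, ℝ) q fun x => (√(σ x))⁻¹ := fun x =>
    ContDiffAt.comp_contMDiffAt (g := fun y => (√y)⁻¹) (f := σ)
      ((Real.contDiffAt_sqrt (hσ0 x).ne').inv (Real.sqrt_ne_zero'.2 (hσ0 x))) (hσ x)
  have hχf : ContMDiff (𝓡 d) 𝓘(ℝ, ℝ) q fun x => χ x * √(f x) := fun x => by
    by_cases hx : f x = 0
    · have : (fun x => χ x * √(f x)) =ᶠ[𝓝 x] fun _ => 0 := by
        filter_upwards [hs1 x hx] with y hy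
        simp [χ, Real.smoothTransition.zero_of_nonpos (sub_nonpos.2 hy)]
      exact contMDiffAt_const.congr_of_eventuallyEq this
    · exact (hχ x).mul ((Real.contDiffAt_sqrt hx).comp_contMDiffAt (hf x))
  refine ⟨Sum.elim (fun i x => (√(σ x))⁻¹ * h i x) fun _ x => (√(σ x))⁻¹ * (χ x * √(f x)), ?_, ?_, ?_⟩
  · rintro (i | _)
    · exact hinv.mul (hh i)
    · exact hinv.mul hχf
  · refine locallyFinite_sum.2 ⟨?_, locallyFinite_of_finite _⟩
    exact hfin.subset fun i => tsupport_mul_subset_right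
  · intro x
    have h1 : f x = (σ x)⁻¹ * (s x * f x) + (σ x)⁻¹ * (χ x ^ 2 * f x) := by
      have := (hσ0 x).ne'
      field_simp
      simp only [σ]
    rw [h1]
    have h2 : ∀ a : ℝ, ((√(σ x))⁻¹ * a) ^ 2 = (σ x)⁻¹ * a ^ 2 := fun a => by
      rw [mul_pow, inv_pow, Real.sq_sqrt (hσ0 x).le]
    refine HasSum.sum ?_ ?_
    · simpa only [Function.comp_def, Sum.elim_inl, h2] using (hsum x).mul_left _
    · have h3 : (χ x * √(f x)) ^ 2 = χ x ^ 2 * f x := by rw [mul_pow, Real.sq_sqrt (h0 x)]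
      simp only [Function.comp_def, Sum.elim_inr, h2, h3]
      exact hasSum_unique fun _ : Unit => (σ x)⁻¹ * (χ x ^ 2 * f x)

theorem locallyFinite_support_of_tsupport {ι : Type*} {ψ : ι → M → ℝ}
    (h : LocallyFinite fun i => tsupport (ψ i)) : LocallyFinite fun i => Function.support (ψ i) :=
  h.subset fun i => subset_tsupport (ψ i)

variable [T2Space M] [SecondCountableTopology M]

/-- With bump functions ψᵢ and s = Σ ψᵢ², the products of ψᵢ with the local summands have squares
adding up to s f. -/
theorem exists_isSumOfSquaresOf {q : ℕ} [IsManifold (𝓡 d) q M] {f : M → ℝ}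
    (hf : ContMDiff (𝓡 d) 𝓘(ℝ, ℝ) q f) (h0 : ∀ x, 0 ≤ f x) (hloc : ∀ x ∈ zeros f,
      ∃ (U : Set M) (g : Fin d → M → ℝ), IsOpen U ∧ x ∈ U ∧
        (∀ i, ContMDiffOn (𝓡 d) 𝓘(ℝ, ℝ) q (g i) U) ∧ ∀ y ∈ U, f y = ∑ i, g i y ^ 2) :
    ∃ ι : Type, Countable ι ∧ (IsCompact (zeros f) → Finite ι) ∧
      ∃ g : ι → M → ℝ, IsSumOfSquaresOf d q f g := by
  have hclosed : IsClosed (zeros f) := isClosed_eq hf.continuous continuous_const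
  choose! U g hU hxU hg hsum using hloc
  obtain ⟨ι, c, ψ, hι, hc, hψ, hψ0, hfin, hψU, hcψ, hψ1⟩ := exists_bump_cover (d := d) q hclosed
    (U := U) fun x hx => (hU x hx).mem_nhds (hxU x hx)
  have hfin' := locallyFinite_support_of_tsupport hfin
  let s : M → ℝ := fun x => ∑ᶠ i, ψ i x ^ 2
  have hpf : ∀ x, {i | ψ i x ≠ 0}.Finite := fun x => hfin'.point_finite x
  have hs : ContMDiff (𝓡 d) 𝓘(ℝ, ℝ) q s := contMDiff_finsum (fun i => (hψ i).pow 2)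
    (hfin'.subset fun i x hx h => hx (by simp [h]))
  have hs1 : ∀ x ∈ zeros f, ∀ᶠ y in 𝓝 x, 1 ≤ s y := fun x hx => by
    obtain ⟨i, hi⟩ := hψ1 x hx
    filter_upwards [hi] with y hy
    have := single_le_finsum i ((hpf y).subset fun j hj h => hj (by simp [h]))
      (fun j => sq_nonneg (ψ j y))
    simpa [hy] using this
  obtain ⟨G, hG⟩ := exists_isSumOfSquaresOf_of_near_zeros hf h0 hs
    (fun x => finsum_nonneg fun i => sq_nonneg _) hs1
    (h := fun (a : ι × Fin d) x => ψ a.1 x * g (c a.1) a.2 x)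
    (fun a => contMDiff_mul_of_tsupport_subset (hψ a.1) (hU _ (hc _)) (hg _ (hc _) _) (hψU _))
    (fun x => by
      obtain ⟨t, ht, htf⟩ := hfin x
      refine ⟨t, ht, (htf.prod finite_univ).subset fun a ha => ⟨?_, mem_univ _⟩⟩
      exact ha.mono (inter_subset_inter_left t tsupport_mul_subset_left))
    (fun x => by
      have hx : s x * f x = ∑ a ∈ (hpf x).toFinset ×ˢ Finset.univ,
          (ψ a.1 x * g (c a.1) a.2 x) ^ 2 := by
        rw [Finset.sum_product, show s x = ∑ i ∈ (hpf x).toFinset, ψ i x ^ 2 from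
          finsum_eq_sum_of_support_subset _ fun i hi => by simpa using hi, Finset.sum_mul]
        refine Finset.sum_congr rfl fun i hi => ?_
        have hxi : x ∈ U (c i) := hψU i (subset_tsupport _ (by simpa using hi))
        rw [hsum _ (hc i) x hxi, Finset.mul_sum]
        exact Finset.sum_congr rfl fun j _ => by ring
      rw [hx]
      refine hasSum_sum_of_ne_finset_zero fun a ha => ?_
      have : ψ a.1 x = 0 := by simpa using ha
      simp [this])
  refine ⟨(ι × Fin d) ⊕ Unit, inferInstance, fun hK => ?_, G, hG⟩
  -- Every bump support contains its centre, which is a zero; only finitely many supports meet a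
  -- compact zero set.
  have : Finite ι := by
    refine finite_univ_iff.1 ((hfin.finite_nonempty_inter_compact hK).subset fun i _ => ?_)
    exact ⟨c i, hcψ i, hc i⟩
  infer_instance

/-- Balls of half the isolation radius work: if two of them meet, their centres are closer than the
larger isolation radius. -/
theorem exists_pairwiseDisjoint_nhds_of_discrete {X : Type*} [TopologicalSpace X]
    [TopologicalSpace.MetrizableSpace X] {s : Set X} (hs : DiscreteTopology s) :
    ∃ V : X → Set X, (∀ x ∈ s, V x ∈ 𝓝 x) ∧
      ∀ x ∈ s, ∀ y ∈ s, (V x ∩ V y).Nonempty → x = y := by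
  let := TopologicalSpace.metrizableSpaceMetric X
  have h : ∀ x ∈ s, ∃ r > 0, ∀ y ∈ s, dist y x < r → y = x := fun x hx => by
    obtain ⟨U, hU, hUs⟩ := discreteTopology_subtype_iff'.1 hs x hx
    have hxU : x ∈ U := (hUs.symm.subset rfl).1
    obtain ⟨r, hr, hrU⟩ := Metric.isOpen_iff.1 hU x hxU
    exact ⟨r, hr, fun y hy hyr => hUs.subset ⟨hrU hyr, hy⟩⟩
  choose! r hr hrs using h
  refine ⟨fun x => Metric.ball x (r x / 2), fun x hx => Metric.ball_mem_nhds x (half_pos (hr x hx)),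
    fun x hx y hy ⟨z, hz1, hz2⟩ => ?_⟩
  rw [Metric.mem_ball] at hz1 hz2
  have htri := dist_triangle_left x y z
  rcases le_total (r x) (r y) with h | h
  · exact hrs y hy x hx (by linarith)
  · exact (hrs x hx y hy (by rw [dist_comm]; linarith)).symm

/-- All bump functions nonzero at a given point share one centre, hence the same local summands g_j.
So Σ ψᵢ g_j = Ψ g_j there, and d functions are enough for Ψ² f. -/
theorem exists_isSumOfSquaresOf_of_discrete {q : ℕ} [IsManifold (𝓡 d) q M] {f : M → ℝ}
    (hf : ContMDiff (𝓡 d) 𝓘(ℝ, ℝ) q f) (h0 : ∀ x, 0 ≤ f x) (hdisc : DiscreteTopology (zeros f))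
    (hloc : ∀ x ∈ zeros f,
      ∃ (U : Set M) (g : Fin d → M → ℝ), IsOpen U ∧ x ∈ U ∧
        (∀ i, ContMDiffOn (𝓡 d) 𝓘(ℝ, ℝ) q (g i) U) ∧ ∀ y ∈ U, f y = ∑ i, g i y ^ 2) :
    ∃ g : Fin d ⊕ Unit → M → ℝ, IsSumOfSquaresOf d q f g := by
  have : LocallyCompactSpace M := ChartedSpace.locallyCompactSpace (EuclideanSpace ℝ (Fin d)) M
  have hclosed : IsClosed (zeros f) := isClosed_eq hf.continuous continuous_const
  choose! U g hU hxU hg hsum using hloc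
  have : TopologicalSpace.MetrizableSpace M := TopologicalSpace.metrizableSpace_of_t3_secondCountable M
  obtain ⟨V, hV, hVd⟩ := exists_pairwiseDisjoint_nhds_of_discrete hdisc
  obtain ⟨ι, c, ψ, hι, hc, hψ, hψ0, hfin, hψU, hcψ, hψ1⟩ := exists_bump_cover (d := d) q hclosed
    (U := fun x => U x ∩ V x) fun x hx => inter_mem ((hU x hx).mem_nhds (hxU x hx)) (hV x hx)
  have hfin' := locallyFinite_support_of_tsupport hfin
  have hpf : ∀ x, {i | ψ i x ≠ 0}.Finite := fun x => hfin'.point_finite x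
  let Ψ : M → ℝ := fun x => ∑ᶠ i, ψ i x
  have hΨ : ContMDiff (𝓡 d) 𝓘(ℝ, ℝ) q Ψ := contMDiff_finsum hψ hfin'
  have hΨ1 : ∀ x ∈ zeros f, ∀ᶠ y in 𝓝 x, 1 ≤ Ψ y ^ 2 := fun x hx => by
    obtain ⟨i, hi⟩ := hψ1 x hx
    filter_upwards [hi] with y hy
    have := single_le_finsum i (hpf y) (fun j => hψ0 j y)
    rw [hy] at this
    exact one_le_pow₀ this
  refine exists_isSumOfSquaresOf_of_near_zeros hf h0 (hΨ.pow 2) (fun x => sq_nonneg _) hΨ1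
    (h := fun j x => ∑ᶠ i, ψ i x * g (c i) j x) (fun j => ?_) (locallyFinite_of_finite _)
    (fun x => ?_)
  · refine contMDiff_finsum (fun i => ?_) (hfin'.subset fun i => Function.support_mul_subset_left _ _)
    exact contMDiff_mul_of_tsupport_subset (hψ i) (hU _ (hc i)) (hg _ (hc i) j)
      ((hψU i).trans inter_subset_left)
  · suffices h : Ψ x ^ 2 * f x = ∑ j, (∑ᶠ i, ψ i x * g (c i) j x) ^ 2 by
      rw [h]
      exact hasSum_fintype _
    by_cases hx : ∃ i, ψ i x ≠ 0
    · obtain ⟨i₀, hi₀⟩ := hx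
      have hmem : ∀ i, ψ i x ≠ 0 → x ∈ U (c i) ∩ V (c i) := fun i hi => hψU i (subset_tsupport _ hi)
      have h1 : ∀ j, ∑ᶠ i, ψ i x * g (c i) j x = Ψ x * g (c i₀) j x := fun j => by
        rw [finsum_mul]
        refine finsum_congr fun i => ?_
        by_cases hi : ψ i x = 0
        · simp [hi]
        · rw [hVd (c i) (hc i) (c i₀) (hc i₀) ⟨x, (hmem i hi).2, (hmem i₀ hi₀).2⟩]
      simp only [h1, mul_pow, ← Finset.mul_sum, ← hsum _ (hc i₀) x (hmem i₀ hi₀).1]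
    · push Not at hx
      simp [Ψ, hx]

end Gluing

end SumOfSquares

theorem mainTheorem3 (d p : ℕ) (hp : 2 ≤ p) {M : Type*} [TopologicalSpace M] [T2Space M]
    [SecondCountableTopology M] [ChartedSpace (EuclideanSpace ℝ (Fin d)) M]
    [IsManifold (𝓡 d) p M] (f : M → ℝ) (hf : ContMDiff (𝓡 d) 𝓘(ℝ, ℝ) p f)
    (hf_nonneg : ∀ x, 0 ≤ f x) (hf_nhc : SumOfSquares.GlobalNormalHessianCondition d f) :
    (∃ ι : Type, Countable ι ∧ ∃ g : ι → M → ℝ, SumOfSquares.IsSumOfSquaresOf d (p - 2) f g) ∧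
    (SumOfSquares.StrictHessianCondition d f →
      DiscreteTopology (SumOfSquares.zeros f) ∧
      ∃ ι : Type, Finite ι ∧ Nat.card ι ≤ d + 1 ∧
        ∃ g : ι → M → ℝ, SumOfSquares.IsSumOfSquaresOf d (p - 2) f g) ∧
    (IsCompact (SumOfSquares.zeros f) →
      ∃ ι : Type, Finite ι ∧
        ∃ g : ι → M → ℝ, SumOfSquares.IsSumOfSquaresOf d (p - 2) f g) := by
  obtain ⟨n, rfl⟩ := Nat.exists_eq_add_of_le' hp
  rw [Nat.add_sub_cancel]
  have hn : (n : WithTop ℕ∞) ≤ (n + 2 : ℕ) := by exact_mod_cast Nat.le_add_right n 2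
  have : IsManifold (𝓡 d) n M := IsManifold.of_le hn
  have hfn : ContMDiff (𝓡 d) 𝓘(ℝ, ℝ) n f := hf.of_le hn
  have hloc := fun x hx => (hf_nhc x hx).exists_sum_sq hf hf_nonneg
  obtain ⟨ι, hι, hfin, hg⟩ := SumOfSquares.exists_isSumOfSquaresOf hfn hf_nonneg hloc
  refine ⟨⟨ι, hι, hg⟩, fun hstrict => ?_, fun hK => ⟨ι, hfin hK, hg⟩⟩
  have hdisc : DiscreteTopology (SumOfSquares.zeros f) := by
    refine discreteTopology_subtype_iff.2 fun x hx => ?_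
    rw [← disjoint_iff, Filter.disjoint_principal_right]
    exact hstrict.eventually_ne_zero hf hf_nonneg hx
  refine ⟨hdisc, Fin d ⊕ Unit, inferInstance, by simp, ?_⟩
  exact SumOfSquares.exists_isSumOfSquaresOf_of_discrete hfn hf_nonneg hdisc hloc
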